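/- **Setting.** Let $\mathcal K=\{1,\dots,K\}$ be a finite set of actions, and let $G_1,G_2,\dots$ be deterministic directed graphs on $\mathcal K$, each containing all self-loops; write $j\overset{t}{\to}i$ if $(j,i)$ is an arc of $G_t$. On a probability space let $p^*$ be a random probability distribution on $[0,1]^{\mathcal K}$ (with an arbitrary prior law; the coordinates under $p^*$ may be dependent) and let $\boldsymbol Y_t=(Y_{t,a})_{a\in\mathcal K}$, $t\ge 1$, be random vectors in $[0,1]^{\mathcal K}$ which, conditionally on $p^*$, are i.i.d. with law $p^*$. Let $A^*$ be a measurable function of $p^*$ with $A^*\in\arg\max_{a\in\mathcal K}\int y_a\,dp^*(y)$. In round $t$ an action $A_t\in\mathcal K$ is played and $Y_{t,a}$ is observed for every $a$ with $A_t\overset{t}{\to}a$. Let $\mathcal F_t$ be the $\sigma$-algebra generated by the actions and observations of rounds $1,\dots,t-1$ (so $\mathcal F_1$ is trivial), let $\alpha_t(a)=\mathbb P(A^*=a\mid\mathcal F_t)$, so that $\alpha_1$ is the law of $A^*$, and let $H(\alpha_1)=-\sum_{a\in\mathcal K}\alpha_1(a)\log\alpha_1(a)$ with the natural logarithm and $0\log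 0=0$. For a probability vector $\pi$ on $\mathcal K$ let $$Q_t(\pi)=\sum_{i\in\mathcal K}\frac{\pi(i)}{\sum_{j:\,j\overset{t}{\to}i}\pi(j)},\qquad \tfrac00=0 .$$ **Theorem.** Let $\epsilon\in[0,1]$ and let $T$ be a time horizon. Suppose that the actions are chosen by TS-U: for each $t\le T$, the action $A_t$ is sampled, with randomness independent of everything else given the history, from $$\boldsymbol\pi_t=(1-\epsilon)\,\alpha_t+\epsilon/K ,$$ that is, $\mathbb P(A_t=a\mid \mathcal F_t,\,p^*,\,(\boldsymbol Y_s)_{s\ge 1})=\boldsymbol\pi_t(a)$ almost surely for every $a\in\mathcal K$. Then the Bayesian regret satisfies $$\mathbb E\Big[\sum_{t=1}^T\big(Y_{t,A^*}-Y_{t,A_t}\big)\Big]\;\le\;\epsilon T+\sqrt{\tfrac12\sum_{t=1}^T\mathbb E\big[Q_t(\boldsymbol\pi_t)\big]\,H(\alpha_1)} .$$ -/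

import Mathlib

open MeasureTheory ProbabilityTheory

noncomputable section

namespace GraphBandit

/-- A vector of rewards, one in `[0,1]` for each of the `K` actions. -/
abbrev RewardVec (K : ℕ) : Type := Fin K → unitInterval

/-- The mean reward of action `a` under the reward distribution `p`. -/
def armMean {K : ℕ} (p : ProbabilityMeasure (RewardVec K)) (a : Fin K) : ℝ :=
  ∫ y, (y a : ℝ) ∂(p : Measure (RewardVec K))

/-- What is observed in one round with feedback graph `G` when action `i` is played and the
reward vector is `y`: the action `i`, and `y a` for every out-neighbour `a` of `i`.
The entries that are not observed are replaced by `0`; which entries these are is determined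
by `i`, so that nothing about `y` is disclosed by this. -/
def observation {K : ℕ} (G : Digraph (Fin K)) (i : Fin K) (y : RewardVec K) :
    Fin K × RewardVec K :=
  open Classical in (i, fun a => if G.Adj i a then y a else 0)

/-- The σ-algebra generated by the observations of all rounds before round `t`
(rounds are numbered from `0`, so the history of round `0` is trivial). -/
@[reducible]
def history {Ω : Type*} {K : ℕ} (G : ℕ → Digraph (Fin K)) (Y : ℕ → Ω → RewardVec K)
    (A : ℕ → Ω → Fin K) (t : ℕ) : MeasurableSpace Ω :=
  MeasurableSpace.comap (fun ω (s : Fin t) => observation (G s) (A s ω) (Y s ω)) inferInstance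

/-- The posterior probability, at round `t`, that the optimal action is `a`. -/
def posteriorProb {Ω : Type*} [MeasurableSpace Ω] {K : ℕ} (μ : Measure Ω)
    (G : ℕ → Digraph (Fin K)) (Astar : Ω → Fin K) (Y : ℕ → Ω → RewardVec K)
    (A : ℕ → Ω → Fin K) (t : ℕ) (a : Fin K) : Ω → ℝ :=
  μ⟦Astar ⁻¹' {a} | history G Y A t⟧

/-- The sampling distribution of Thompson sampling mixed with uniform exploration:
`π_t = (1 - ε) α_t + ε / K`. -/
def tsuPolicy {Ω : Type*} [MeasurableSpace Ω] {K : ℕ} (μ : Measure Ω)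
    (G : ℕ → Digraph (Fin K)) (Astar : Ω → Fin K) (Y : ℕ → Ω → RewardVec K)
    (A : ℕ → Ω → Fin K) (ε : ℝ) (t : ℕ) (a : Fin K) (ω : Ω) : ℝ :=
  (1 - ε) * posteriorProb μ G Astar Y A t a ω + ε / K

/-- The Bayesian stochastic bandit: `pstar` is a random reward distribution; conditionally on
`pstar` the reward vectors `Y 0, Y 1, …` are independent with common law `pstar`; and `Astar`
is an optimal action for `pstar`, chosen as a function of `pstar`. -/
structure IsBayesianBandit {Ω : Type*} [MeasurableSpace Ω] {K : ℕ} (μ : Measure Ω)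
    (pstar : Ω → ProbabilityMeasure (RewardVec K)) (Astar : Ω → Fin K)
    (Y : ℕ → Ω → RewardVec K) : Prop where
  measurable_pstar : Measurable pstar
  measurable_reward : ∀ t, Measurable (Y t)
  cond_iid : ∀ (S : Finset ℕ) (B : ℕ → Set (RewardVec K)), (∀ s, MeasurableSet (B s)) →
    μ⟦⋂ s ∈ S, Y s ⁻¹' B s | MeasurableSpace.comap pstar inferInstance⟧
      =ᵐ[μ] fun ω => ∏ s ∈ S, (pstar ω : Measure (RewardVec K)).real (B s)
  measurable_Astar : Measurable[MeasurableSpace.comap pstar inferInstance] Astar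
  optimal : ∀ ω a, armMean (pstar ω) a ≤ armMean (pstar ω) (Astar ω)

/-- In each of the rounds `0, …, T - 1` the action is drawn from the distribution `π t` with
fresh randomness: given the history, the reward distribution and all reward vectors, the
conditional probability of playing `a` in round `t` is `π t a`. -/
structure PlaysPolicy {Ω : Type*} [MeasurableSpace Ω] {K : ℕ} (μ : Measure Ω)
    (G : ℕ → Digraph (Fin K)) (pstar : Ω → ProbabilityMeasure (RewardVec K))
    (Y : ℕ → Ω → RewardVec K) (A : ℕ → Ω → Fin K) (T : ℕ) (π : ℕ → Fin K → Ω → ℝ) :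
    Prop where
  measurable_action : ∀ t, Measurable (A t)
  sampling : ∀ t < T, ∀ a,
    μ⟦A t ⁻¹' {a} | history G Y A t ⊔ MeasurableSpace.comap pstar inferInstance
        ⊔ MeasurableSpace.comap (fun ω s => Y s ω) inferInstance⟧ =ᵐ[μ] π t a

/-- The Bayesian regret over the rounds `0, …, T - 1`. -/
def bayesRegret {Ω : Type*} [MeasurableSpace Ω] {K : ℕ} (μ : Measure Ω) (Astar : Ω → Fin K)
    (Y : ℕ → Ω → RewardVec K) (A : ℕ → Ω → Fin K) (T : ℕ) : ℝ :=
  ∫ ω, ∑ t ∈ Finset.range T, ((Y t ω (Astar ω) : ℝ) - (Y t ω (A t ω) : ℝ)) ∂μ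

/-- `Q(p) = ∑_i p(i) / ∑_{j → i} p(j)`, with the convention `0 / 0 = 0`. -/
def graphQ {K : ℕ} (G : Digraph (Fin K)) (p : Fin K → ℝ) : ℝ :=
  open Classical in ∑ i, p i / ∑ j with G.Adj j i, p j

/-- Shannon entropy (natural logarithm, `0 log 0 = 0`). -/
def shannonEntropy {K : ℕ} (p : Fin K → ℝ) : ℝ :=
  -∑ i, p i * Real.log (p i)

/-- The prior distribution of the optimal action. -/
def prior {Ω : Type*} [MeasurableSpace Ω] {K : ℕ} (μ : Measure Ω) (Astar : Ω → Fin K)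
    (a : Fin K) : ℝ :=
  μ.real (Astar ⁻¹' {a})

end GraphBandit

end

/-!
Fix a round and an action `a`. Given the history, let `α` be the probability that `a` is the
target, `q` the probability that the reward `y` of `a` is observed, `h` the mean of `y`, and `d`
the amount by which the mean of `y` given that `a` is the target exceeds `h`. As the policy plays
`a` with probability at least `(1 - ε) α`, the regret of the round is at most
`ε + (1 - ε) ∑ₐ E[α d]`. By the Cauchy–Schwarz inequality the square of `(1 - ε) ∑ E[α d]`, summed
over actions and rounds, is at most `∑ E[Q]` times `∑ E[α q d²]`.

The last factor is at most half the entropy of the target. To see this, apply the Gibbs variational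
inequality for the entropy of the posterior to the test function `b (l (y - h) - l² / 8)`, where
`b` indicates that `y` is observed, so that the function is known after the round. Its exponential
has conditional mean at most `1` by Hoeffding's lemma, because the decision to observe is
conditionally independent of `y`. For `l = 4 d` this shows that the entropy drops by at least
`2 E[α q d²]` in expectation. The drops telescope over the rounds.
-/

theorem exp_mul_le_chord {y : ℝ} (hy : y ∈ Set.Icc 0 1) (l : ℝ) :
    Real.exp (y * l) ≤ y * (Real.exp l - 1) + 1 := by
  have h := convexOn_exp.2 (Set.mem_univ (0 : ℝ)) (Set.mem_univ l) (sub_nonneg.2 hy.2) hy.1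
    (sub_add_cancel 1 y)
  simp only [smul_eq_mul, mul_zero, zero_add, Real.exp_zero, mul_one] at h
  linarith

theorem bernoulli_mgf_le {p : ℝ} (hp : p ∈ Set.Icc 0 1) (l : ℝ) :
    p * (Real.exp l - 1) + 1 ≤ Real.exp (l * p + l ^ 2 / 8) := by
  let ν : Measure ℝ := bernoulliMeasure 1 0 ⟨p, hp⟩
  have hν : ∀ᵐ x ∂ν, id x ∈ Set.Icc (0 : ℝ) 1 :=
    (mem_ae_iff_prob_eq_one measurableSet_Icc).2 <|
      bernoulliMeasure_apply_of_mem_of_mem _ measurableSet_Icc (by simp) (by simp)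
  have hmean : ∫ x, id x ∂ν = p := by simp [ν, integral_bernoulliMeasure]
  have hoeffding := (hasSubgaussianMGF_of_mem_Icc measurable_id.aemeasurable hν).mgf_le l
  rw [hmean, mgf, integral_bernoulliMeasure] at hoeffding
  have hvar : ((‖(1 : ℝ) - 0‖₊ / 2) ^ 2 : NNReal) * l ^ 2 / 2 = l ^ 2 / 8 := by
    norm_num
    ring
  rw [hvar] at hoeffding
  calc p * (Real.exp l - 1) + 1
      = Real.exp (l * p) * (p * Real.exp (l * (1 - p)) + (1 - p) * Real.exp (l * (0 - p))) := by
        simp only [mul_sub, mul_one, mul_zero, Real.exp_sub, Real.exp_zero]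
        field_simp
        ring
    _ ≤ Real.exp (l * p) * Real.exp (l ^ 2 / 8) := by
        gcongr
        exact hoeffding
    _ = Real.exp (l * p + l ^ 2 / 8) := (Real.exp_add _ _).symm

theorem negMulLog_add_mul_le {x m : ℝ} (hx : 0 ≤ x) (hm : 0 < m) (f : ℝ) :
    x.negMulLog + x * (f + (Real.log m + 1)) ≤ m * Real.exp f := by
  rcases hx.eq_or_lt with rfl | hx
  · simpa using by positivity
  have hlog := Real.log_le_sub_one_of_pos (x := m * Real.exp f / x) (by positivity)
  rw [Real.log_div (by positivity) hx.ne', Real.log_mul hm.ne' (Real.exp_pos f).ne',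
    Real.log_exp] at hlog
  calc x.negMulLog + x * (f + (Real.log m + 1))
      = x * (Real.log m + f - Real.log x) + x := by rw [Real.negMulLog]; ring
    _ ≤ x * (m * Real.exp f / x - 1) + x := by gcongr
    _ = m * Real.exp f := by field_simp; ring

theorem sub_negMulLog_le_mul_log_add {x δ : ℝ} (hx : 0 ≤ x) (hδ : 0 ≤ δ) :
    x - x.negMulLog ≤ x * (Real.log (x + δ) + 1) := by
  rcases hx.eq_or_lt with rfl | hx
  · simp
  calc x - x.negMulLog = x * (Real.log x + 1) := by rw [Real.negMulLog]; ring
    _ ≤ x * (Real.log (x + δ) + 1) := by gcongr; linarith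

theorem sq_le_mul_of_forall_two_mul_le {x a b : ℝ} (h : ∀ c : ℝ, 2 * c * x ≤ c ^ 2 * a + b) :
    x ^ 2 ≤ a * b := by
  have hdiscrim : discrim a (-(2 * x)) b ≤ 0 := discrim_le_zero fun c => by linarith [h c]
  rw [discrim] at hdiscrim
  linarith

theorem two_mul_mul_le_div_add {p r q M : ℝ} (hp : 0 ≤ p) (hpM : p ≤ M) (hpr : p ≤ r)
    (hrq : r ≤ q) (c d : ℝ) : 2 * c * (p * d) ≤ c ^ 2 * (r / q) + M * q * d ^ 2 := by
  rcases (hp.trans (hpr.trans hrq)).eq_or_lt with rfl | hq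
  · simp [le_antisymm (hpr.trans hrq) hp]
  calc 2 * c * (p * d) ≤ 2 * c * (p * d) + p / q * (c - q * d) ^ 2 := by
        linarith [show 0 ≤ p / q * (c - q * d) ^ 2 by positivity]
    _ = c ^ 2 * (p / q) + p * q * d ^ 2 := by field_simp; ring
    _ ≤ c ^ 2 * (r / q) + M * q * d ^ 2 := by gcongr

/-- `f` represents an element of `L^∞(m, μ)`: it is essentially bounded and almost everywhere equal
to an `m`-measurable function. -/
@[fun_prop]
structure BddMeas {Ω : Type*} (m : MeasurableSpace Ω) {mΩ : MeasurableSpace Ω} (μ : Measure Ω)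
    (f : Ω → ℝ) : Prop where
  aestronglyMeasurable : AEStronglyMeasurable[m] f μ
  memLp_top : MemLp f ⊤ μ

namespace BddMeas

variable {Ω : Type*} {m m' mΩ : MeasurableSpace Ω} {μ : Measure Ω} {f g : Ω → ℝ} {a b : ℝ}

theorem mono (h : m ≤ m') (hf : BddMeas m μ f) : BddMeas m' μ f :=
  ⟨hf.aestronglyMeasurable.mono h, hf.memLp_top⟩

theorem of_mem_Icc (hm : m ≤ mΩ) (hf : AEStronglyMeasurable[m] f μ)
    (h : ∀ᵐ ω ∂μ, f ω ∈ Set.Icc a b) : BddMeas m μ f :=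
  ⟨hf, memLp_top_of_bound (hf.mono hm) (max |a| |b|) <|
    h.mono fun _ hω => abs_le_max_abs_abs hω.1 hω.2⟩

theorem exists_mem_Icc (hf : BddMeas m μ f) : ∃ C, ∀ᵐ ω ∂μ, f ω ∈ Set.Icc (-C) C := by
  have hlt : eLpNormEssSup f μ < ⊤ := by simpa only [eLpNorm_exponent_top] using hf.memLp_top.2
  refine ⟨(eLpNormEssSup f μ).toReal, (ae_le_eLpNormEssSup (f := f)).mono fun ω hω => ?_⟩
  simpa only [Set.mem_Icc, ← abs_le, ← Real.norm_eq_abs, toReal_enorm] using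
    ENNReal.toReal_mono hlt.ne hω

theorem integrable [IsFiniteMeasure μ] (hf : BddMeas m μ f) : Integrable f μ :=
  hf.memLp_top.integrable le_top

@[fun_prop]
theorem const (c : ℝ) : BddMeas m μ fun _ => c :=
  ⟨aestronglyMeasurable_const, memLp_top_const c⟩

@[fun_prop]
theorem add (hf : BddMeas m μ f) (hg : BddMeas m μ g) : BddMeas m μ fun ω => f ω + g ω :=
  ⟨hf.aestronglyMeasurable.add hg.aestronglyMeasurable, hf.memLp_top.add hg.memLp_top⟩

@[fun_prop]
theorem sub (hf : BddMeas m μ f) (hg : BddMeas m μ g) : BddMeas m μ fun ω => f ω - g ω :=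
  ⟨hf.aestronglyMeasurable.sub hg.aestronglyMeasurable, hf.memLp_top.sub hg.memLp_top⟩

@[fun_prop]
theorem mul (hf : BddMeas m μ f) (hg : BddMeas m μ g) : BddMeas m μ fun ω => f ω * g ω :=
  ⟨hf.aestronglyMeasurable.mul hg.aestronglyMeasurable, hg.memLp_top.mul' hf.memLp_top⟩

@[fun_prop]
theorem neg (hf : BddMeas m μ f) : BddMeas m μ fun ω => -f ω :=
  ⟨hf.aestronglyMeasurable.neg, hf.memLp_top.neg⟩

@[fun_prop]
theorem div_const (hf : BddMeas m μ f) (c : ℝ) : BddMeas m μ fun ω => f ω / c := by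
  simpa only [div_eq_mul_inv] using hf.mul (const c⁻¹)

@[fun_prop]
theorem pow (hf : BddMeas m μ f) (n : ℕ) : BddMeas m μ fun ω => f ω ^ n := by
  induction n with
  | zero => simpa only [pow_zero] using const 1
  | succ n ih => simpa only [pow_succ] using ih.mul hf

@[fun_prop]
theorem sum {ι : Type*} {s : Finset ι} {F : ι → Ω → ℝ} (hF : ∀ i ∈ s, BddMeas m μ (F i)) :
    BddMeas m μ fun ω => ∑ i ∈ s, F i ω := by
  simpa only [← Finset.sum_apply] using
    Finset.sum_induction F (BddMeas m μ) (fun _ _ => add) (const 0) hF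

theorem div_of_mem_Icc (hm : m ≤ mΩ) (hf : BddMeas m μ f) (hg : BddMeas m μ g)
    (h : ∀ᵐ ω ∂μ, f ω / g ω ∈ Set.Icc a b) : BddMeas m μ fun ω => f ω / g ω :=
  .of_mem_Icc hm (hf.aestronglyMeasurable.div₀ hg.aestronglyMeasurable) h

theorem comp_continuousOn {φ : ℝ → ℝ} (hφ : Measurable φ) (hc : ContinuousOn φ (Set.Icc a b))
    (hf : BddMeas m μ f) (hmem : ∀ᵐ ω ∂μ, f ω ∈ Set.Icc a b) :
    BddMeas m μ fun ω => φ (f ω) := by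
  obtain ⟨C, hC⟩ := isCompact_Icc.exists_bound_of_continuousOn hc
  obtain ⟨f', hf', hff'⟩ := hf.aestronglyMeasurable
  refine ⟨⟨fun ω => φ (f' ω), (hφ.comp hf'.measurable).stronglyMeasurable,
    hff'.mono fun ω hω => congrArg φ hω⟩, memLp_top_of_bound ?_ C <| hmem.mono fun ω hω => hC _ hω⟩
  exact (hφ.comp_aemeasurable hf.memLp_top.1.aemeasurable).aestronglyMeasurable

theorem comp_continuous {φ : ℝ → ℝ} (hφ : Continuous φ) (hf : BddMeas m μ f) :
    BddMeas m μ fun ω => φ (f ω) := by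
  obtain ⟨C, hC⟩ := hf.exists_mem_Icc
  exact hf.comp_continuousOn hφ.measurable hφ.continuousOn hC

@[fun_prop]
theorem exp (hf : BddMeas m μ f) : BddMeas m μ fun ω => Real.exp (f ω) :=
  hf.comp_continuous Real.continuous_exp

@[fun_prop]
theorem negMulLog (hf : BddMeas m μ f) : BddMeas m μ fun ω => Real.negMulLog (f ω) :=
  hf.comp_continuous Real.continuous_negMulLog

theorem log_add_const {δ : ℝ} (hδ : 0 < δ) (hf : BddMeas m μ f) (hf0 : 0 ≤ᵐ[μ] f) :
    BddMeas m μ fun ω => Real.log (f ω + δ) := by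
  obtain ⟨C, hC⟩ := (hf.add (const δ)).exists_mem_Icc
  refine (hf.add (const δ)).comp_continuousOn (a := δ) (b := C) Real.measurable_log
    (Real.continuousOn_log.mono fun x hx => (hδ.trans_le hx.1).ne') ?_
  filter_upwards [hC, hf0] with ω hCω hω using ⟨le_add_of_nonneg_left hω, hCω.2⟩

theorem condExp (hf : BddMeas m' μ f) : BddMeas m μ (μ[f | m]) :=
  ⟨stronglyMeasurable_condExp.aestronglyMeasurable, hf.memLp_top.condExp le_top⟩

end BddMeas

section CondExp

variable {Ω : Type*} {m m' 𝒢 mΩ : MeasurableSpace Ω} {μ : Measure Ω} [IsFiniteMeasure μ]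
  {f g u v : Ω → ℝ} {a b : ℝ}

theorem condExp_mem_Icc (hm : m ≤ mΩ) (hf : Integrable f μ) (h : ∀ᵐ ω ∂μ, f ω ∈ Set.Icc a b) :
    ∀ᵐ ω ∂μ, (μ[f | m]) ω ∈ Set.Icc a b := by
  have hlower := condExp_mono (m := m) (integrable_const a) hf (h.mono fun _ hω => hω.1)
  have hupper := condExp_mono (m := m) hf (integrable_const b) (h.mono fun _ hω => hω.2)
  rw [condExp_const hm] at hlower hupper
  filter_upwards [hlower, hupper] with ω hl hu using ⟨hl, hu⟩

theorem condExp_ae_eq_of_le (hm : m ≤ 𝒢) (h𝒢 : 𝒢 ≤ mΩ) (hfg : μ[f | 𝒢] =ᵐ[μ] g)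
    (hg : AEStronglyMeasurable[m] g μ) : μ[f | m] =ᵐ[μ] g :=
  calc μ[f | m] =ᵐ[μ] μ[μ[f | 𝒢] | m] := (condExp_condExp_of_le hm h𝒢).symm
    _ =ᵐ[μ] μ[g | m] := condExp_congr_ae hfg
    _ =ᵐ[μ] g := condExp_of_aestronglyMeasurable' (hm.trans h𝒢) hg
      (integrable_condExp.congr hfg)

theorem condExp_mul_add (hm : m ≤ mΩ) (hf : BddMeas mΩ μ f) (hu : BddMeas m μ u)
    (hv : BddMeas m μ v) :
    μ[fun ω => f ω * u ω + v ω | m] =ᵐ[μ] fun ω => (μ[f | m]) ω * u ω + v ω := by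
  have hmul := condExp_mul_of_aestronglyMeasurable_right hu.aestronglyMeasurable
    (hf.mul (hu.mono hm)).integrable hf.integrable
  have hconst := condExp_of_aestronglyMeasurable' hm hv.aestronglyMeasurable hv.integrable
  filter_upwards [condExp_add (hf.mul (hu.mono hm)).integrable hv.integrable m, hmul, hconst]
    with ω hadd hmul hconst
  exact hadd.trans (congrArg₂ (· + ·) hmul hconst)

theorem integral_condExp_mul (hm : m ≤ mΩ) (hf : BddMeas mΩ μ f) (hg : BddMeas m μ g) :
    ∫ ω, (μ[f | m]) ω * g ω ∂μ = ∫ ω, f ω * g ω ∂μ := by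
  have hfg : Integrable (f * g) μ := (hf.mul (hg.mono hm)).integrable
  rw [← integral_condExp hm (f := fun ω => f ω * g ω)]
  exact integral_congr_ae (condExp_mul_of_aestronglyMeasurable_right hg.aestronglyMeasurable hfg
    hf.integrable).symm

theorem condExp_mul_of_condExp_ae_eq (hm : m ≤ 𝒢) (h𝒢 : 𝒢 ≤ mΩ) (hf : BddMeas mΩ μ f)
    (hfm : μ[f | 𝒢] =ᵐ[μ] μ[f | m]) (hg : BddMeas 𝒢 μ g) :
    μ[fun ω => f ω * g ω | m] =ᵐ[μ] fun ω => (μ[f | m]) ω * (μ[g | m]) ω :=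
  have hgΩ := hg.mono h𝒢
  calc μ[f * g | m] =ᵐ[μ] μ[μ[f * g | 𝒢] | m] := (condExp_condExp_of_le hm h𝒢).symm
    _ =ᵐ[μ] μ[μ[f | 𝒢] * g | m] :=
      condExp_congr_ae <| condExp_mul_of_aestronglyMeasurable_right hg.aestronglyMeasurable
        (hf.mul hgΩ).integrable hf.integrable
    _ =ᵐ[μ] μ[μ[f | m] * g | m] := condExp_congr_ae (hfm.mul .rfl)
    _ =ᵐ[μ] μ[f | m] * μ[g | m] :=
      condExp_mul_of_stronglyMeasurable_left stronglyMeasurable_condExp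
        ((hf.condExp.mono (hm.trans h𝒢)).mul hgΩ).integrable hgΩ.integrable

end CondExp

section InformationGain

variable {Ω : Type*} {m m' 𝒢 mΩ : MeasurableSpace Ω} {μ : Measure Ω} [IsFiniteMeasure μ]
  {s y b f l w : Ω → ℝ}

theorem condExp_exp_mul_sub_le_one (hm : m ≤ mΩ) (hy : BddMeas mΩ μ y)
    (hy01 : ∀ᵐ ω ∂μ, y ω ∈ Set.Icc 0 1) (hl : BddMeas m μ l) :
    μ[fun ω => Real.exp (l ω * (y ω - (μ[y | m]) ω) - l ω ^ 2 / 8) | m] ≤ᵐ[μ] 1 := by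
  let g : Ω → ℝ := fun ω => Real.exp (-(l ω * (μ[y | m]) ω + l ω ^ 2 / 8))
  have hh : BddMeas m μ (μ[y | m]) := hy.condExp
  have hg : BddMeas m μ g := by fun_prop
  have hu : BddMeas m μ fun ω => g ω * (Real.exp (l ω) - 1) := by fun_prop
  have hlΩ := hl.mono hm
  have hhΩ := hh.mono hm
  have hchord : (fun ω => Real.exp (l ω * (y ω - (μ[y | m]) ω) - l ω ^ 2 / 8)) ≤ᵐ[μ]
      fun ω => y ω * (g ω * (Real.exp (l ω) - 1)) + g ω := by
    filter_upwards [hy01] with ω hyω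
    calc Real.exp (l ω * (y ω - (μ[y | m]) ω) - l ω ^ 2 / 8)
        = g ω * Real.exp (y ω * l ω) := by rw [← Real.exp_add]; ring_nf
      _ ≤ g ω * (y ω * (Real.exp (l ω) - 1) + 1) := by
        gcongr
        exact exp_mul_le_chord hyω _
      _ = y ω * (g ω * (Real.exp (l ω) - 1)) + g ω := by ring
  have hmono := condExp_mono (m := m) (BddMeas.integrable (by fun_prop))
    ((hy.mul (hu.mono hm)).add (hg.mono hm)).integrable hchord
  filter_upwards [hmono, condExp_mul_add hm hy hu hg, condExp_mem_Icc hm hy.integrable hy01]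
    with ω hmono hlin hhω
  calc _ ≤ (μ[y | m]) ω * (g ω * (Real.exp (l ω) - 1)) + g ω := hmono.trans_eq hlin
    _ = g ω * ((μ[y | m]) ω * (Real.exp (l ω) - 1) + 1) := by ring
    _ ≤ g ω * Real.exp (l ω * (μ[y | m]) ω + l ω ^ 2 / 8) := by
      gcongr
      exact bernoulli_mgf_le hhω _
    _ = 1 := by rw [← Real.exp_add, neg_add_cancel, Real.exp_zero]

theorem condExp_exp_mul_le_one_of_condExp_ae_eq (hm : m ≤ 𝒢) (h𝒢 : 𝒢 ≤ mΩ)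
    (hb : BddMeas mΩ μ b) (hb01 : ∀ᵐ ω ∂μ, b ω ∈ Set.Icc 0 1) (hbm : μ[b | 𝒢] =ᵐ[μ] μ[b | m])
    (hw : BddMeas 𝒢 μ w) (hexp : μ[fun ω => Real.exp (w ω) | m] ≤ᵐ[μ] 1) :
    μ[fun ω => Real.exp (b ω * w ω) | m] ≤ᵐ[μ] 1 := by
  have hmΩ := hm.trans h𝒢
  have hwΩ := hw.mono h𝒢
  have he : BddMeas 𝒢 μ fun ω => Real.exp (w ω) - 1 := by fun_prop
  have heΩ := he.mono h𝒢
  have hchord : (fun ω => Real.exp (b ω * w ω)) ≤ᵐ[μ]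
      (fun ω => b ω * (Real.exp (w ω) - 1)) + fun _ => 1 :=
    hb01.mono fun ω hbω => exp_mul_le_chord hbω (w ω)
  have hmono := condExp_mono (m := m) (hb.mul hwΩ).exp.integrable
    ((hb.mul heΩ).integrable.add (integrable_const 1)) hchord
  have hadd := condExp_add (hb.mul heΩ).integrable (integrable_const 1) m
  have hsub := condExp_sub hwΩ.exp.integrable (integrable_const 1) m
  rw [condExp_const hmΩ] at hadd hsub
  filter_upwards [hmono, hadd, hsub, condExp_mul_of_condExp_ae_eq hm h𝒢 hb hbm he, hexp,
    condExp_mem_Icc hmΩ hb.integrable hb01] with ω hmono hadd hsub hmul hexpω hbω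
  calc _ ≤ (μ[b | m]) ω * ((μ[fun ω => Real.exp (w ω) | m]) ω - 1) + 1 :=
        (hmono.trans_eq hadd).trans_eq <|
          congrArg (· + 1) (hmul.trans (congrArg ((μ[b | m]) ω * ·) hsub))
    _ ≤ 1 := by
      linarith [mul_nonneg hbω.1 (sub_nonneg.2 (show _ ≤ (1 : ℝ) from hexpω))]

theorem integral_mul_exp_le (hm : m ≤ m') (hm' : m' ≤ mΩ) (hf : BddMeas m' μ f)
    (hexp : μ[fun ω => Real.exp (f ω) | m] ≤ᵐ[μ] 1) (hw : BddMeas m μ w) (hw0 : 0 ≤ᵐ[μ] w) :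
    ∫ ω, w ω * Real.exp (f ω) ∂μ ≤ ∫ ω, w ω ∂μ := by
  have hmΩ := hm.trans hm'
  have hexpf : BddMeas m μ (μ[fun ω => Real.exp (f ω) | m]) := hf.exp.condExp
  calc ∫ ω, w ω * Real.exp (f ω) ∂μ
      = ∫ ω, (μ[fun ω => Real.exp (f ω) | m]) ω * w ω ∂μ := by
        rw [integral_condExp_mul hmΩ (hf.exp.mono hm') hw]
        simp only [mul_comm]
    _ ≤ ∫ ω, w ω ∂μ := by
      refine integral_mono_ae (hexpf.mul hw).integrable hw.integrable ?_
      filter_upwards [hexp, hw0] with ω hexpω hω using mul_le_of_le_one_left hω hexpω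

theorem integral_negMulLog_condExp_add_le (hm : m ≤ m') (hm' : m' ≤ mΩ) (hs : BddMeas mΩ μ s)
    (hs0 : 0 ≤ᵐ[μ] s) (hf : BddMeas m' μ f) (hexp : μ[fun ω => Real.exp (f ω) | m] ≤ᵐ[μ] 1) :
    ∫ ω, Real.negMulLog ((μ[s | m']) ω) ∂μ + ∫ ω, s ω * f ω ∂μ
      ≤ ∫ ω, Real.negMulLog ((μ[s | m]) ω) ∂μ := by
  have hmΩ := hm.trans hm'
  have hM : BddMeas m μ (μ[s | m]) := hs.condExp
  have hM' : BddMeas m' μ (μ[s | m']) := hs.condExp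
  have hM0 := condExp_nonneg (m := m) hs0
  refine le_of_forall_pos_le_add fun η hη => ?_
  -- Adding `δ` keeps the logarithm bounded where `μ[s | m]` vanishes.
  obtain ⟨δ, hδ, hδη⟩ := exists_pos_mul_lt hη (μ.real Set.univ)
  have hL : BddMeas m μ fun ω => Real.log ((μ[s | m]) ω + δ) + 1 :=
    (hM.log_add_const hδ hM0).add (.const 1)
  have hfL := hf.add (hL.mono hm)
  have hfΩ := hf.mono hm'
  have hLΩ := hL.mono hmΩ
  have hdual : ∫ ω, Real.negMulLog ((μ[s | m']) ω) ∂μ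
      + (∫ ω, s ω * f ω ∂μ + ∫ ω, (μ[s | m]) ω * (Real.log ((μ[s | m]) ω + δ) + 1) ∂μ)
      ≤ ∫ ω, ((μ[s | m]) ω + δ) * Real.exp (f ω) ∂μ := by
    rw [integral_condExp_mul hmΩ hs hL, ← integral_add (hs.mul hfΩ).integrable
      (hs.mul hLΩ).integrable]
    simp only [← mul_add]
    rw [← integral_condExp_mul hm' hs hfL, ← integral_add hM'.negMulLog.integrable
      (hM'.mul hfL).integrable]
    refine integral_mono_ae (hM'.negMulLog.add (hM'.mul hfL)).integrable
      (((hM.mono hm).add (.const δ)).mul hf.exp).integrable ?_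
    filter_upwards [hM0, condExp_nonneg (m := m') hs0] with ω hMω hM'ω
    exact negMulLog_add_mul_le hM'ω (add_pos_of_nonneg_of_pos hMω hδ) _
  have hexpδ := integral_mul_exp_le hm hm' hf hexp (hM.add (.const δ))
    (hM0.mono fun ω hω => add_nonneg hω hδ.le)
  have hprior : ∫ ω, (μ[s | m]) ω - Real.negMulLog ((μ[s | m]) ω) ∂μ
      ≤ ∫ ω, (μ[s | m]) ω * (Real.log ((μ[s | m]) ω + δ) + 1) ∂μ :=
    integral_mono_ae (hM.sub hM.negMulLog).integrable (hM.mul hL).integrable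
      (hM0.mono fun ω hω => sub_negMulLog_le_mul_log_add hω hδ.le)
  rw [integral_sub hM.integrable hM.negMulLog.integrable] at hprior
  rw [integral_add hM.integrable (integrable_const δ), integral_const,
    smul_eq_mul] at hexpδ
  linarith

/-- The gap between the conditional mean given `m` of `y` weighted by `s` and its unweighted
conditional mean. Division by zero makes the weighted mean `0` where `μ[s | m]` vanishes; this
is harmless, since the gap is only used multiplied by `μ[s | m]`. -/
noncomputable def condMeanGap (μ : Measure Ω) (m : MeasurableSpace Ω) (s y : Ω → ℝ) (ω : Ω) : ℝ :=
  (μ[fun ω => s ω * y ω | m]) ω / (μ[s | m]) ω - (μ[y | m]) ω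

theorem condExp_mul_mem_Icc (hs : BddMeas mΩ μ s) (hs0 : 0 ≤ᵐ[μ] s) (hy : BddMeas mΩ μ y)
    (hy01 : ∀ᵐ ω ∂μ, y ω ∈ Set.Icc 0 1) :
    ∀ᵐ ω ∂μ, (μ[fun ω => s ω * y ω | m]) ω ∈ Set.Icc 0 ((μ[s | m]) ω) := by
  have hnonneg : 0 ≤ᵐ[μ] fun ω => s ω * y ω := by
    filter_upwards [hs0, hy01] with ω hs hy using mul_nonneg hs hy.1
  have hle : (fun ω => s ω * y ω) ≤ᵐ[μ] s := by
    filter_upwards [hs0, hy01] with ω hs hy using mul_le_of_le_one_right hs hy.2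
  filter_upwards [condExp_nonneg (m := m) hnonneg,
    condExp_mono (m := m) (hs.mul hy).integrable hs.integrable hle] with ω h0 h1 using ⟨h0, h1⟩

theorem condExp_mul_condMeanGap (hs : BddMeas mΩ μ s) (hs0 : 0 ≤ᵐ[μ] s) (hy : BddMeas mΩ μ y)
    (hy01 : ∀ᵐ ω ∂μ, y ω ∈ Set.Icc 0 1) :
    ∀ᵐ ω ∂μ, (μ[s | m]) ω * condMeanGap μ m s y ω
      = (μ[fun ω => s ω * y ω | m]) ω - (μ[s | m]) ω * (μ[y | m]) ω := by
  filter_upwards [condExp_mul_mem_Icc (m := m) hs hs0 hy hy01] with ω hN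
  rcases eq_or_ne ((μ[s | m]) ω) 0 with hM | hM
  · rw [hM] at hN ⊢
    linarith [hN.1, hN.2]
  · rw [condMeanGap, mul_sub, mul_div_cancel₀ _ hM]

theorem BddMeas.condMeanGap (hm : m ≤ mΩ) (hs : BddMeas mΩ μ s) (hs0 : 0 ≤ᵐ[μ] s)
    (hy : BddMeas mΩ μ y) (hy01 : ∀ᵐ ω ∂μ, y ω ∈ Set.Icc 0 1) :
    BddMeas m μ (condMeanGap μ m s y) := by
  have hweighted := (hs.mul hy).condExp.div_of_mem_Icc (a := 0) (b := 1) hm hs.condExp <|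
    (condExp_mul_mem_Icc hs hs0 hy hy01).mono fun ω hN =>
      ⟨div_nonneg hN.1 (hN.1.trans hN.2), div_le_one_of_le₀ hN.2 (hN.1.trans hN.2)⟩
  exact hweighted.sub hy.condExp

theorem condExp_mul_tilt (hm : m ≤ mΩ) (hs : BddMeas mΩ μ s) (hs0 : 0 ≤ᵐ[μ] s)
    (hy : BddMeas mΩ μ y) (hy01 : ∀ᵐ ω ∂μ, y ω ∈ Set.Icc 0 1) :
    let d := condMeanGap μ m s y
    μ[fun ω => s ω * (4 * d ω * (y ω - (μ[y | m]) ω) - 2 * d ω ^ 2) | m]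
      =ᵐ[μ] fun ω => 2 * ((μ[s | m]) ω * d ω ^ 2) := by
  intro d
  have hd : BddMeas m μ d := .condMeanGap hm hs hs0 hy hy01
  have hu : BddMeas m μ fun ω => 4 * d ω := by fun_prop
  have hv : BddMeas m μ fun ω => 4 * d ω * (μ[y | m]) ω + 2 * d ω ^ 2 :=
    (hu.mul hy.condExp).add (by fun_prop)
  have hsyu := (hs.mul hy).mul (hu.mono hm)
  have hsv := hs.mul (hv.mono hm)
  have hsplit : (fun ω => s ω * (4 * d ω * (y ω - (μ[y | m]) ω) - 2 * d ω ^ 2))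
      = (fun ω => s ω * y ω * (4 * d ω))
        - fun ω => s ω * (4 * d ω * (μ[y | m]) ω + 2 * d ω ^ 2) := by
    ext ω
    rw [Pi.sub_apply]
    ring
  rw [hsplit]
  filter_upwards [condExp_sub hsyu.integrable hsv.integrable m,
    condExp_mul_of_aestronglyMeasurable_right hu.aestronglyMeasurable hsyu.integrable
      (hs.mul hy).integrable,
    condExp_mul_of_aestronglyMeasurable_right hv.aestronglyMeasurable hsv.integrable
      hs.integrable, condExp_mul_condMeanGap (m := m) hs hs0 hy hy01] with ω hsub hsyu hsv hgap
  calc _ = (μ[fun ω => s ω * y ω | m]) ω * (4 * d ω)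
          - (μ[s | m]) ω * (4 * d ω * (μ[y | m]) ω + 2 * d ω ^ 2) :=
        hsub.trans (congrArg₂ (· - ·) hsyu hsv)
    _ = 2 * ((μ[s | m]) ω * d ω ^ 2) := by linear_combination (-4 * d ω) * hgap

theorem integral_negMulLog_condExp_add_condMeanGap_le (hm : m ≤ m') (hm' : m' ≤ mΩ)
    (hm𝒢 : m ≤ 𝒢) (h𝒢 : 𝒢 ≤ mΩ) (hs : BddMeas 𝒢 μ s) (hs0 : 0 ≤ᵐ[μ] s) (hy : BddMeas 𝒢 μ y)
    (hy01 : ∀ᵐ ω ∂μ, y ω ∈ Set.Icc 0 1) (hb : BddMeas m' μ b)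
    (hb01 : ∀ᵐ ω ∂μ, b ω ∈ Set.Icc 0 1) (hby : BddMeas m' μ fun ω => b ω * y ω)
    (hbm : μ[b | 𝒢] =ᵐ[μ] μ[b | m]) :
    ∫ ω, Real.negMulLog ((μ[s | m']) ω) ∂μ
        + 2 * ∫ ω, (μ[s | m]) ω * (μ[b | m]) ω * condMeanGap μ m s y ω ^ 2 ∂μ
      ≤ ∫ ω, Real.negMulLog ((μ[s | m]) ω) ∂μ := by
  have hmΩ := hm.trans hm'
  have hsΩ := hs.mono h𝒢
  have hyΩ := hy.mono h𝒢
  have hbΩ := hb.mono hm'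
  set d := condMeanGap μ m s y
  have hd : BddMeas m μ d := .condMeanGap hmΩ hsΩ hs0 hyΩ hy01
  have hh : BddMeas m μ (μ[y | m]) := hyΩ.condExp
  -- The slope `l = 4 d` maximises the gain `l d - l ^ 2 / 8`, which is then `2 d ^ 2`.
  let w : Ω → ℝ := fun ω => 4 * d ω * (y ω - (μ[y | m]) ω) - 2 * d ω ^ 2
  have hw : BddMeas 𝒢 μ w := by
    have := hd.mono hm𝒢
    have := hh.mono hm𝒢
    fun_prop
  have hbw : BddMeas m' μ fun ω => b ω * w ω := by
    have hd' := hd.mono hm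
    have hh' := hh.mono hm
    have hrevealed : BddMeas m' μ fun ω =>
        4 * d ω * (b ω * y ω) - (4 * d ω * (μ[y | m]) ω + 2 * d ω ^ 2) * b ω := by fun_prop
    convert hrevealed using 2 with ω
    ring
  have hexpw : μ[fun ω => Real.exp (w ω) | m] ≤ᵐ[μ] 1 := by
    convert condExp_exp_mul_sub_le_one hmΩ hyΩ hy01 ((BddMeas.const 4).mul hd) using 6
    ring
  have hexp := condExp_exp_mul_le_one_of_condExp_ae_eq hm𝒢 h𝒢 hbΩ hb01 hbm hw hexpw
  have hgain : ∫ ω, s ω * (b ω * w ω) ∂μ = 2 * ∫ ω, (μ[s | m]) ω * (μ[b | m]) ω * d ω ^ 2 ∂μ := by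
    rw [← integral_condExp hmΩ, ← integral_const_mul]
    simp only [mul_left_comm (s _)]
    refine integral_congr_ae ?_
    filter_upwards [condExp_mul_of_condExp_ae_eq hm𝒢 h𝒢 hbΩ hbm (hs.mul hw),
      condExp_mul_tilt hmΩ hsΩ hs0 hyΩ hy01] with ω hmul htilt
    rw [hmul, htilt]
    ring
  rw [← hgain]
  exact integral_negMulLog_condExp_add_le hm hm' hsΩ hs0 hbw hexp

end InformationGain

namespace GraphBandit

section Definitions

variable {Ω : Type*} {K : ℕ}

/-- The indicator function of the event that the random action `B` is `a`. -/
noncomputable def actionIndicator (B : Ω → Fin K) (a : Fin K) : Ω → ℝ :=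
  (B ⁻¹' {a}).indicator fun _ => 1

/-- The indicator function of the event that playing `B` reveals the reward of `a`. -/
noncomputable def observed (G : Digraph (Fin K)) (B : Ω → Fin K) (a : Fin K) (ω : Ω) : ℝ :=
  open Classical in if G.Adj (B ω) a then 1 else 0

/-- The probability of observing the reward of `a` when the action is drawn from `p`. -/
noncomputable def observeProb (G : Digraph (Fin K)) (p : Fin K → ℝ) (a : Fin K) : ℝ :=
  open Classical in ∑ j with G.Adj j a, p j

/-- The σ-algebra generated by the history, the target action and the rewards of round `t`. -/
noncomputable abbrev preAction (G : ℕ → Digraph (Fin K)) (Astar : Ω → Fin K)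
    (Y : ℕ → Ω → RewardVec K) (A : ℕ → Ω → Fin K) (t : ℕ) : MeasurableSpace Ω :=
  history G Y A t ⊔ MeasurableSpace.comap Astar inferInstance
    ⊔ MeasurableSpace.comap (Y t) inferInstance

variable [MeasurableSpace Ω]

/-- A bandit without a model for the rewards, in which an arbitrary random action `Astar` is the
target: in each round `t < T` the action is drawn with fresh randomness from a distribution `π t`
that depends on the history only. Freshness is required only relative to the target and the
rewards of the same round. -/
structure IsAdaptiveSampling (μ : Measure Ω) (G : ℕ → Digraph (Fin K)) (Astar : Ω → Fin K)
    (Y : ℕ → Ω → RewardVec K) (A : ℕ → Ω → Fin K) (T : ℕ) (π : ℕ → Fin K → Ω → ℝ) : Prop where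
  measurable_target : Measurable Astar
  measurable_reward : ∀ t, Measurable (Y t)
  measurable_action : ∀ t, Measurable (A t)
  aestronglyMeasurable_policy : ∀ t < T, ∀ a, AEStronglyMeasurable[history G Y A t] (π t a) μ
  sampling : ∀ t < T, ∀ a, μ⟦A t ⁻¹' {a} | preAction G Astar Y A t⟧ =ᵐ[μ] π t a

/-- The posterior mean reward of `a` in round `t` given that `a` is the target, minus its
posterior mean reward. -/
noncomputable def targetGap (μ : Measure Ω) (G : ℕ → Digraph (Fin K)) (Astar : Ω → Fin K)
    (Y : ℕ → Ω → RewardVec K) (A : ℕ → Ω → Fin K) (t : ℕ) (a : Fin K) : Ω → ℝ :=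
  condMeanGap μ (history G Y A t) (actionIndicator Astar a) fun ω => (Y t ω a : ℝ)

/-- The expected regret in round `t` of drawing the action from the posterior distribution of the
target, as pure Thompson sampling does. -/
noncomputable def thompsonRegret (μ : Measure Ω) (G : ℕ → Digraph (Fin K)) (Astar : Ω → Fin K)
    (Y : ℕ → Ω → RewardVec K) (A : ℕ → Ω → Fin K) (t : ℕ) : ℝ :=
  ∑ a, ∫ ω, posteriorProb μ G Astar Y A t a ω * targetGap μ G Astar Y A t a ω ∂μ

/-- The expected squared target gaps, weighted by the probability that the action is the target
and is observed. By Pinsker's inequality twice this quantity is a lower bound for the information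
about the target that is gained in round `t`. -/
noncomputable def observedSqGap (μ : Measure Ω) (G : ℕ → Digraph (Fin K)) (Astar : Ω → Fin K)
    (Y : ℕ → Ω → RewardVec K) (A : ℕ → Ω → Fin K) (π : ℕ → Fin K → Ω → ℝ) (t : ℕ) : ℝ :=
  ∑ a, ∫ ω, posteriorProb μ G Astar Y A t a ω * observeProb (G t) (fun j => π t j ω) a
    * targetGap μ G Astar Y A t a ω ^ 2 ∂μ

end Definitions

section Measurability

variable {Ω : Type*} {m mΩ : MeasurableSpace Ω} {μ : Measure Ω} {K : ℕ}
  {G : ℕ → Digraph (Fin K)} {Y : ℕ → Ω → RewardVec K} {A : ℕ → Ω → Fin K} {B : Ω → Fin K}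

theorem measurable_observation (G : Digraph (Fin K)) :
    Measurable fun p : Fin K × RewardVec K => observation G p.1 p.2 := by
  classical
  unfold observation
  refine measurable_fst.prodMk (measurable_pi_lambda _ fun a => Measurable.ite ?_ ?_ ?_)
  · exact measurable_fst (MeasurableSet.of_discrete (s := {i | G.Adj i a}))
  · exact (measurable_pi_apply a).comp measurable_snd
  · exact measurable_const

theorem history_le (hA : ∀ t, Measurable (A t)) (hY : ∀ t, Measurable (Y t)) (t : ℕ) :
    history G Y A t ≤ mΩ :=
  Measurable.comap_le <| measurable_pi_lambda _ fun r =>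
    (measurable_observation (G r)).comp ((hA r).prodMk (hY r))

theorem measurable_history_observation {r t : ℕ} (h : r < t) :
    Measurable[history G Y A t] fun ω => observation (G r) (A r ω) (Y r ω) :=
  (measurable_pi_apply (⟨r, h⟩ : Fin t)).comp
    (comap_measurable fun ω (r : Fin t) => observation (G r) (A r ω) (Y r ω))

theorem history_mono {r t : ℕ} (h : r ≤ t) : history G Y A r ≤ history G Y A t := by
  refine measurable_iff_comap_le.1 ?_
  exact @measurable_pi_lambda _ _ _ (history G Y A t) _ _ fun i =>
    measurable_history_observation (i.2.trans_le h)

theorem history_zero : history G Y A 0 = ⊥ := by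
  have hconst : (fun ω (r : Fin 0) => observation (G r) (A r ω) (Y r ω)) = fun _ => default :=
    funext fun _ => Subsingleton.elim _ _
  rw [history, hconst, MeasurableSpace.comap_const]

theorem history_le_preAction {Astar : Ω → Fin K} {t : ℕ} :
    history G Y A t ≤ preAction G Astar Y A t :=
  le_sup_left.trans le_sup_left

theorem actionIndicator_mem_Icc (B : Ω → Fin K) (a : Fin K) (ω : Ω) :
    actionIndicator B a ω ∈ Set.Icc (0 : ℝ) 1 :=
  ⟨Set.indicator_nonneg (fun _ _ => zero_le_one) ω,
    Set.indicator_le_self' (fun _ _ => zero_le_one) ω⟩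

theorem apply_eq_sum_actionIndicator_mul (B : Ω → Fin K) (F : Fin K → Ω → ℝ) :
    (fun ω => F (B ω) ω) = fun ω => ∑ a, actionIndicator B a ω * F a ω := by
  ext ω
  rw [Finset.sum_eq_single (B ω)]
  · simp [actionIndicator]
  · intro a _ ha
    simp [actionIndicator, ha.symm]
  · simp

theorem observed_mem_Icc (G : Digraph (Fin K)) (B : Ω → Fin K) (a : Fin K) (ω : Ω) :
    observed G B a ω ∈ Set.Icc (0 : ℝ) 1 := by
  rw [observed]
  split_ifs <;> simp

theorem observed_eq_sum_actionIndicator (G : Digraph (Fin K)) (B : Ω → Fin K) (a : Fin K) :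
    open Classical in observed G B a = ∑ j with G.Adj j a, actionIndicator B j := by
  classical
  ext ω
  rw [Finset.sum_apply, Finset.sum_filter]
  simpa [observed] using congrFun
    (apply_eq_sum_actionIndicator_mul B fun j _ => if G.Adj j a then (1 : ℝ) else 0) ω

theorem le_observeProb {G : Digraph (Fin K)} {p : Fin K → ℝ} {a : Fin K} (ha : G.Adj a a)
    (hp : ∀ j, 0 ≤ p j) : p a ≤ observeProb G p a := by
  classical
  exact Finset.single_le_sum (fun j _ => hp j) (by simp [ha])

theorem bddMeas_actionIndicator (hm : m ≤ mΩ) (hB : Measurable[m] B) (a : Fin K) :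
    BddMeas m μ (actionIndicator B a) :=
  .of_mem_Icc hm (measurable_const.indicator
    (hB (measurableSet_singleton a))).stronglyMeasurable.aestronglyMeasurable
    (.of_forall (actionIndicator_mem_Icc B a))

theorem bddMeas_observeProb {p : Fin K → Ω → ℝ} (G : Digraph (Fin K))
    (hp : ∀ a, BddMeas m μ (p a)) (a : Fin K) :
    BddMeas m μ fun ω => observeProb G (fun j => p j ω) a :=
  .sum fun j _ => hp j

theorem bddMeas_observed {t : ℕ} (hm : history G Y A (t + 1) ≤ mΩ) (a : Fin K) :
    BddMeas (history G Y A (t + 1)) μ (observed (G t) (A t) a) := by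
  classical
  refine .of_mem_Icc hm ?_ (.of_forall (observed_mem_Icc (G t) (A t) a))
  exact ((measurable_of_finite fun i => if (G t).Adj i a then (1 : ℝ) else 0).comp
    (measurable_fst.comp (measurable_history_observation (Y := Y)
      t.lt_succ_self))).stronglyMeasurable.aestronglyMeasurable

theorem bddMeas_observed_mul_reward {t : ℕ} (hm : history G Y A (t + 1) ≤ mΩ) (a : Fin K) :
    BddMeas (history G Y A (t + 1)) μ fun ω => observed (G t) (A t) a ω * (Y t ω a : ℝ) := by
  have hobs : (fun ω => observed (G t) (A t) a ω * (Y t ω a : ℝ))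
      = fun ω => ((observation (G t) (A t ω) (Y t ω)).2 a : ℝ) := by
    ext ω
    simp only [observed, observation]
    split_ifs <;> simp
  rw [hobs]
  exact .of_mem_Icc hm (measurable_subtype_coe.comp ((measurable_pi_apply a).comp
    (measurable_snd.comp (measurable_history_observation
      t.lt_succ_self)))).stronglyMeasurable.aestronglyMeasurable
    (.of_forall fun ω => ((observation (G t) (A t ω) (Y t ω)).2 a).2)

end Measurability

namespace IsAdaptiveSampling

variable {Ω : Type*} [MeasurableSpace Ω] {μ : Measure Ω} {K : ℕ}
  {G : ℕ → Digraph (Fin K)} {Astar : Ω → Fin K} {Y : ℕ → Ω → RewardVec K} {A : ℕ → Ω → Fin K}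
  {T t : ℕ} {π : ℕ → Fin K → Ω → ℝ} {ε : ℝ}

theorem history_le (h : IsAdaptiveSampling μ G Astar Y A T π) (t : ℕ) :
    history G Y A t ≤ ‹MeasurableSpace Ω› :=
  GraphBandit.history_le h.measurable_action h.measurable_reward t

theorem preAction_le (h : IsAdaptiveSampling μ G Astar Y A T π) (t : ℕ) :
    preAction G Astar Y A t ≤ ‹MeasurableSpace Ω› :=
  sup_le (sup_le (h.history_le t) h.measurable_target.comap_le)
    (h.measurable_reward t).comap_le

theorem bddMeas_target (h : IsAdaptiveSampling μ G Astar Y A T π) (t : ℕ) (a : Fin K) :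
    BddMeas (preAction G Astar Y A t) μ (actionIndicator Astar a) := by
  have hAstar : Measurable[preAction G Astar Y A t] Astar :=
    (comap_measurable Astar).mono (le_sup_right.trans le_sup_left) le_rfl
  exact bddMeas_actionIndicator (h.preAction_le t) hAstar a

theorem bddMeas_reward (h : IsAdaptiveSampling μ G Astar Y A T π) (t : ℕ) (a : Fin K) :
    BddMeas (preAction G Astar Y A t) μ fun ω => (Y t ω a : ℝ) := by
  have hY : Measurable[preAction G Astar Y A t] (Y t) :=
    (comap_measurable (Y t)).mono le_sup_right le_rfl
  exact .of_mem_Icc (h.preAction_le t) (measurable_subtype_coe.comp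
    ((measurable_pi_apply a).comp hY)).stronglyMeasurable.aestronglyMeasurable
    (.of_forall fun ω => (Y t ω a).2)

theorem bddMeas_posteriorProb (h : IsAdaptiveSampling μ G Astar Y A T π) (t : ℕ) (a : Fin K) :
    BddMeas (history G Y A t) μ (posteriorProb μ G Astar Y A t a) :=
  (h.bddMeas_target t a).condExp

section Finite

variable [IsFiniteMeasure μ]

theorem policy_mem_Icc (h : IsAdaptiveSampling μ G Astar Y A T π) (ht : t < T) :
    ∀ᵐ ω ∂μ, ∀ a, π t a ω ∈ Set.Icc 0 1 := by
  refine ae_all_iff.2 fun a => ?_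
  filter_upwards [h.sampling t ht a, condExp_mem_Icc (h.preAction_le t)
    (bddMeas_actionIndicator le_rfl (h.measurable_action t) a).integrable
    (.of_forall (actionIndicator_mem_Icc (A t) a))] with ω hω hmem
  rw [← hω]
  exact hmem

theorem bddMeas_policy (h : IsAdaptiveSampling μ G Astar Y A T π) (ht : t < T) (a : Fin K) :
    BddMeas (history G Y A t) μ (π t a) :=
  .of_mem_Icc (h.history_le t) (h.aestronglyMeasurable_policy t ht a)
    ((h.policy_mem_Icc ht).mono fun _ hω => hω a)

theorem posteriorProb_mem_Icc (h : IsAdaptiveSampling μ G Astar Y A T π) (t : ℕ) :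
    ∀ᵐ ω ∂μ, ∀ a, posteriorProb μ G Astar Y A t a ω ∈ Set.Icc 0 1 :=
  ae_all_iff.2 fun a => condExp_mem_Icc (h.history_le t) (h.bddMeas_target t a).integrable
    (.of_forall (actionIndicator_mem_Icc Astar a))

theorem bddMeas_targetGap (h : IsAdaptiveSampling μ G Astar Y A T π) (t : ℕ) (a : Fin K) :
    BddMeas (history G Y A t) μ (targetGap μ G Astar Y A t a) :=
  .condMeanGap (h.history_le t) ((h.bddMeas_target t a).mono (h.preAction_le t))
    (.of_forall fun ω => (actionIndicator_mem_Icc Astar a ω).1)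
    ((h.bddMeas_reward t a).mono (h.preAction_le t)) (.of_forall fun ω => (Y t ω a).2)

theorem bddMeas_policy_div_observeProb (h : IsAdaptiveSampling μ G Astar Y A T π) (ht : t < T)
    (hG : ∀ a, (G t).Adj a a) (a : Fin K) :
    BddMeas (history G Y A t) μ
      fun ω => π t a ω / observeProb (G t) (fun j => π t j ω) a := by
  refine (h.bddMeas_policy ht a).div_of_mem_Icc (a := 0) (b := 1) (h.history_le t)
    (bddMeas_observeProb (G t) (h.bddMeas_policy ht) a) ?_
  filter_upwards [h.policy_mem_Icc ht] with ω hπ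
  have hle := le_observeProb (hG a) fun j => (hπ j).1
  exact ⟨div_nonneg (hπ a).1 ((hπ a).1.trans hle), div_le_one_of_le₀ hle ((hπ a).1.trans hle)⟩

theorem condExp_observed (h : IsAdaptiveSampling μ G Astar Y A T π) (ht : t < T) (a : Fin K) :
    μ[observed (G t) (A t) a | preAction G Astar Y A t]
      =ᵐ[μ] fun ω => observeProb (G t) (fun j => π t j ω) a := by
  rw [observed_eq_sum_actionIndicator]
  refine (condExp_finsetSum (fun j _ =>
    (bddMeas_actionIndicator le_rfl (h.measurable_action t) j).integrable) _).trans ?_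
  filter_upwards [ae_all_iff.2 (h.sampling t ht)] with ω hω
  rw [Finset.sum_apply]
  exact Finset.sum_congr rfl fun j _ => hω j

theorem condExp_observed_history (h : IsAdaptiveSampling μ G Astar Y A T π) (ht : t < T)
    (a : Fin K) :
    μ[observed (G t) (A t) a | history G Y A t]
      =ᵐ[μ] fun ω => observeProb (G t) (fun j => π t j ω) a :=
  condExp_ae_eq_of_le history_le_preAction (h.preAction_le t) (h.condExp_observed ht a)
    (bddMeas_observeProb (G t) (h.bddMeas_policy ht) a).aestronglyMeasurable

theorem integral_negMulLog_posteriorProb_succ_le (h : IsAdaptiveSampling μ G Astar Y A T π)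
    (ht : t < T) (a : Fin K) :
    ∫ ω, Real.negMulLog (posteriorProb μ G Astar Y A (t + 1) a ω) ∂μ
        + 2 * ∫ ω, posteriorProb μ G Astar Y A t a ω * observeProb (G t) (fun j => π t j ω) a
          * targetGap μ G Astar Y A t a ω ^ 2 ∂μ
      ≤ ∫ ω, Real.negMulLog (posteriorProb μ G Astar Y A t a ω) ∂μ := by
  have hobs := h.condExp_observed_history ht a
  have hgain := integral_negMulLog_condExp_add_condMeanGap_le (history_mono t.le_succ)
    (h.history_le (t + 1)) history_le_preAction (h.preAction_le t) (h.bddMeas_target t a)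
    (.of_forall fun ω => (actionIndicator_mem_Icc Astar a ω).1) (h.bddMeas_reward t a)
    (.of_forall fun ω => (Y t ω a).2) (bddMeas_observed (h.history_le (t + 1)) a)
    (.of_forall (observed_mem_Icc (G t) (A t) a))
    (bddMeas_observed_mul_reward (h.history_le (t + 1)) a)
    ((h.condExp_observed ht a).trans hobs.symm)
  have hcongr : ∫ ω, posteriorProb μ G Astar Y A t a ω * observeProb (G t) (fun j => π t j ω) a
        * targetGap μ G Astar Y A t a ω ^ 2 ∂μ
      = ∫ ω, posteriorProb μ G Astar Y A t a ω
        * (μ[observed (G t) (A t) a | history G Y A t]) ω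
        * targetGap μ G Astar Y A t a ω ^ 2 ∂μ :=
    integral_congr_ae <| hobs.mono fun ω hω => by simp only [hω]
  rw [hcongr]
  exact hgain

theorem two_mul_observedSqGap_le (h : IsAdaptiveSampling μ G Astar Y A T π) (ht : t < T) :
    2 * observedSqGap μ G Astar Y A π t
      ≤ ∑ a, ∫ ω, Real.negMulLog (posteriorProb μ G Astar Y A t a ω) ∂μ
        - ∑ a, ∫ ω, Real.negMulLog (posteriorProb μ G Astar Y A (t + 1) a ω) ∂μ := by
  rw [observedSqGap, Finset.mul_sum, ← Finset.sum_sub_distrib]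
  exact Finset.sum_le_sum fun a _ =>
    le_sub_iff_add_le'.2 (h.integral_negMulLog_posteriorProb_succ_le ht a)

theorem integrable_reward_apply (h : IsAdaptiveSampling μ G Astar Y A T π) {B : Ω → Fin K}
    (hB : Measurable B) (t : ℕ) : Integrable (fun ω => (Y t ω (B ω) : ℝ)) μ := by
  rw [apply_eq_sum_actionIndicator_mul B fun a ω => (Y t ω a : ℝ)]
  exact integrable_finsetSum _ fun a _ => ((bddMeas_actionIndicator le_rfl hB a).mul
    ((h.bddMeas_reward t a).mono (h.preAction_le t))).integrable

theorem integral_reward_apply (h : IsAdaptiveSampling μ G Astar Y A T π) {B : Ω → Fin K}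
    (hB : Measurable B) (t : ℕ) :
    ∫ ω, (Y t ω (B ω) : ℝ) ∂μ = ∑ a, ∫ ω, actionIndicator B a ω * (Y t ω a : ℝ) ∂μ := by
  rw [apply_eq_sum_actionIndicator_mul B fun a ω => (Y t ω a : ℝ)]
  exact integral_finsetSum _ fun a _ => ((bddMeas_actionIndicator le_rfl hB a).mul
    ((h.bddMeas_reward t a).mono (h.preAction_le t))).integrable

theorem integral_actionIndicator_mul_reward (h : IsAdaptiveSampling μ G Astar Y A T π)
    (ht : t < T) (a : Fin K) :
    ∫ ω, actionIndicator (A t) a ω * (Y t ω a : ℝ) ∂μ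
      = ∫ ω, π t a ω * (μ[fun ω => (Y t ω a : ℝ) | history G Y A t]) ω ∂μ := by
  have hA := bddMeas_actionIndicator (μ := μ) le_rfl (h.measurable_action t) a
  have hπ := condExp_ae_eq_of_le history_le_preAction (h.preAction_le t) (h.sampling t ht a)
    (h.aestronglyMeasurable_policy t ht a)
  rw [← integral_condExp (h.history_le t)]
  refine integral_congr_ae ?_
  filter_upwards [hπ, condExp_mul_of_condExp_ae_eq history_le_preAction (h.preAction_le t) hA
    ((h.sampling t ht a).trans hπ.symm) (h.bddMeas_reward t a)] with ω hπω hmul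
  rw [hmul, ← hπω, actionIndicator]

theorem integral_actionIndicator_sub_le (h : IsAdaptiveSampling μ G Astar Y A T π) (ht : t < T)
    {a : Fin K}
    (hε : ∀ᵐ ω ∂μ, (1 - ε) * posteriorProb μ G Astar Y A t a ω ≤ π t a ω) :
    ∫ ω, actionIndicator Astar a ω * (Y t ω a : ℝ) ∂μ
        - ∫ ω, actionIndicator (A t) a ω * (Y t ω a : ℝ) ∂μ
      ≤ ε * ∫ ω, actionIndicator Astar a ω * (Y t ω a : ℝ) ∂μ
        + (1 - ε) * ∫ ω, posteriorProb μ G Astar Y A t a ω * targetGap μ G Astar Y A t a ω ∂μ := by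
  have hs := (h.bddMeas_target t a).mono (h.preAction_le t)
  have hs0 : 0 ≤ᵐ[μ] actionIndicator Astar a :=
    .of_forall fun ω => (actionIndicator_mem_Icc Astar a ω).1
  have hy := (h.bddMeas_reward t a).mono (h.preAction_le t)
  have hy01 : ∀ᵐ ω ∂μ, (Y t ω a : ℝ) ∈ Set.Icc 0 1 := .of_forall fun ω => (Y t ω a).2
  have hN : BddMeas (history G Y A t) μ
      (μ[fun ω => actionIndicator Astar a ω * (Y t ω a : ℝ) | history G Y A t]) :=
    (hs.mul hy).condExp
  have hh : BddMeas (history G Y A t) μ (μ[fun ω => (Y t ω a : ℝ) | history G Y A t]) :=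
    hy.condExp
  have hπh := (h.bddMeas_policy ht a).mul hh
  have hαd := (h.bddMeas_posteriorProb t a).mul (h.bddMeas_targetGap t a)
  rw [h.integral_actionIndicator_mul_reward ht, ← integral_condExp (h.history_le t),
    ← integral_sub hN.integrable hπh.integrable, ← integral_const_mul, ← integral_const_mul,
    ← integral_add (hN.integrable.const_mul ε) (hαd.integrable.const_mul (1 - ε))]
  refine integral_mono_ae (hN.integrable.sub hπh.integrable)
    ((hN.integrable.const_mul ε).add (hαd.integrable.const_mul (1 - ε))) ?_
  filter_upwards [hε, condExp_mem_Icc (h.history_le t) hy.integrable hy01,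
    condExp_mul_condMeanGap (m := history G Y A t) hs hs0 hy hy01] with ω hεω hhω hgap
  have hexploit := mul_le_mul_of_nonneg_right hεω hhω.1
  have hgap' : posteriorProb μ G Astar Y A t a ω * targetGap μ G Astar Y A t a ω
      = (μ[fun ω => actionIndicator Astar a ω * (Y t ω a : ℝ) | history G Y A t]) ω
        - posteriorProb μ G Astar Y A t a ω
          * (μ[fun ω => (Y t ω a : ℝ) | history G Y A t]) ω := hgap
  linear_combination hexploit - (1 - ε) * hgap'

theorem two_mul_thompsonRegret_le (h : IsAdaptiveSampling μ G Astar Y A T π) (ht : t < T)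
    (hG : ∀ a, (G t).Adj a a) (hε0 : 0 ≤ ε) (hε1 : ε ≤ 1)
    (hε : ∀ a, ∀ᵐ ω ∂μ, (1 - ε) * posteriorProb μ G Astar Y A t a ω ≤ π t a ω) (c : ℝ) :
    2 * c * ((1 - ε) * thompsonRegret μ G Astar Y A t)
      ≤ c ^ 2 * ∫ ω, graphQ (G t) (fun a => π t a ω) ∂μ + observedSqGap μ G Astar Y A π t := by
  have hratio := h.bddMeas_policy_div_observeProb ht hG
  have hgraphQ : ∫ ω, graphQ (G t) (fun a => π t a ω) ∂μ
      = ∑ a, ∫ ω, π t a ω / observeProb (G t) (fun j => π t j ω) a ∂μ :=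
    integral_finsetSum _ fun a _ => (hratio a).integrable
  rw [hgraphQ, thompsonRegret, observedSqGap, ← mul_assoc, Finset.mul_sum, Finset.mul_sum,
    ← Finset.sum_add_distrib]
  refine Finset.sum_le_sum fun a _ => ?_
  have hα := h.bddMeas_posteriorProb t a
  have hd := h.bddMeas_targetGap t a
  have hq := bddMeas_observeProb (G t) (h.bddMeas_policy ht) a
  have hsq := ((hα.mul hq).mul (hd.pow 2)).integrable
  rw [← integral_const_mul, ← integral_const_mul,
    ← integral_add ((hratio a).integrable.const_mul _) hsq]
  refine integral_mono_ae ((hα.mul hd).integrable.const_mul _)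
    (((hratio a).integrable.const_mul _).add hsq) ?_
  filter_upwards [h.policy_mem_Icc ht, h.posteriorProb_mem_Icc t, hε a] with ω hπ hα hεω
  calc _ = 2 * c * ((1 - ε) * posteriorProb μ G Astar Y A t a ω
          * targetGap μ G Astar Y A t a ω) := by ring
    _ ≤ _ := two_mul_mul_le_div_add (mul_nonneg (sub_nonneg.2 hε1) (hα a).1)
      (mul_le_of_le_one_left (hα a).1 (sub_le_self 1 hε0)) hεω
      (le_observeProb (hG a) fun j => (hπ j).1) _ _

end Finite

section Probability

variable [IsProbabilityMeasure μ]

theorem posteriorProb_zero (hAstar : Measurable Astar) (a : Fin K) :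
    posteriorProb μ G Astar Y A 0 a = fun _ => prior μ Astar a := by
  rw [posteriorProb, history_zero, condExp_bot, integral_indicator_const _
    (hAstar (measurableSet_singleton a)), smul_eq_mul, mul_one, prior]

theorem shannonEntropy_prior_eq (hAstar : Measurable Astar) :
    shannonEntropy (prior μ Astar)
      = ∑ a, ∫ ω, Real.negMulLog (posteriorProb μ G Astar Y A 0 a ω) ∂μ := by
  simp only [posteriorProb_zero hAstar, integral_const, probReal_univ, one_smul, shannonEntropy,
    Real.negMulLog, neg_mul, Finset.sum_neg_distrib]

theorem two_mul_sum_observedSqGap_le (h : IsAdaptiveSampling μ G Astar Y A T π) :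
    2 * ∑ t ∈ Finset.range T, observedSqGap μ G Astar Y A π t
      ≤ shannonEntropy (prior μ Astar) := by
  let H : ℕ → ℝ := fun t => ∑ a, ∫ ω, Real.negMulLog (posteriorProb μ G Astar Y A t a ω) ∂μ
  have hT : 0 ≤ H T := Finset.sum_nonneg fun a _ => integral_nonneg_of_ae <|
    (h.posteriorProb_mem_Icc T).mono fun ω hω => Real.negMulLog_nonneg (hω a).1 (hω a).2
  calc 2 * ∑ t ∈ Finset.range T, observedSqGap μ G Astar Y A π t
      ≤ ∑ t ∈ Finset.range T, (H t - H (t + 1)) := by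
        rw [Finset.mul_sum]
        exact Finset.sum_le_sum fun t ht => h.two_mul_observedSqGap_le (Finset.mem_range.1 ht)
    _ = H 0 - H T := Finset.sum_range_sub' H T
    _ ≤ shannonEntropy (prior μ Astar) := by
        rw [shannonEntropy_prior_eq (G := G) (Y := Y) (A := A) h.measurable_target]
        exact sub_le_self _ hT

theorem integral_reward_sub_le (h : IsAdaptiveSampling μ G Astar Y A T π) (ht : t < T)
    (hε0 : 0 ≤ ε) (hε : ∀ a, ∀ᵐ ω ∂μ, (1 - ε) * posteriorProb μ G Astar Y A t a ω ≤ π t a ω) :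
    ∫ ω, ((Y t ω (Astar ω) : ℝ) - (Y t ω (A t ω) : ℝ)) ∂μ
      ≤ ε + (1 - ε) * thompsonRegret μ G Astar Y A t := by
  have hYstar := h.integrable_reward_apply h.measurable_target t
  have hstar : ∫ ω, (Y t ω (Astar ω) : ℝ) ∂μ ≤ 1 := by
    simpa using integral_mono hYstar (integrable_const 1) fun ω => (Y t ω (Astar ω)).2.2
  have hround := Finset.sum_le_sum fun a (_ : a ∈ Finset.univ) =>
    h.integral_actionIndicator_sub_le ht (hε a)
  rw [Finset.sum_sub_distrib, Finset.sum_add_distrib, ← Finset.mul_sum, ← Finset.mul_sum,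
    ← h.integral_reward_apply h.measurable_target,
    ← h.integral_reward_apply (h.measurable_action t)] at hround
  rw [integral_sub hYstar (h.integrable_reward_apply (h.measurable_action t) t)]
  exact hround.trans (add_le_add_left (mul_le_of_le_one_right hε0 hstar) _)

theorem bayesRegret_le (h : IsAdaptiveSampling μ G Astar Y A T π) (hε0 : 0 ≤ ε)
    (hε : ∀ t < T, ∀ a, ∀ᵐ ω ∂μ, (1 - ε) * posteriorProb μ G Astar Y A t a ω ≤ π t a ω) :
    bayesRegret μ Astar Y A T
      ≤ ε * T + ∑ t ∈ Finset.range T, (1 - ε) * thompsonRegret μ G Astar Y A t := by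
  calc bayesRegret μ Astar Y A T
      = ∑ t ∈ Finset.range T, ∫ ω, ((Y t ω (Astar ω) : ℝ) - (Y t ω (A t ω) : ℝ)) ∂μ :=
        integral_finsetSum _ fun t _ => (h.integrable_reward_apply h.measurable_target t).sub
          (h.integrable_reward_apply (h.measurable_action t) t)
    _ ≤ ∑ t ∈ Finset.range T, (ε + (1 - ε) * thompsonRegret μ G Astar Y A t) :=
        Finset.sum_le_sum fun t ht => h.integral_reward_sub_le (Finset.mem_range.1 ht) hε0
          (hε t (Finset.mem_range.1 ht))
    _ = _ := by
        rw [Finset.sum_add_distrib, Finset.sum_const, Finset.card_range, nsmul_eq_mul, mul_comm]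

end Probability

end IsAdaptiveSampling

section Policy

variable {Ω : Type*} [MeasurableSpace Ω] {μ : Measure Ω} {K : ℕ} {G : ℕ → Digraph (Fin K)}
  {pstar : Ω → ProbabilityMeasure (RewardVec K)} {Astar : Ω → Fin K} {Y : ℕ → Ω → RewardVec K}
  {A : ℕ → Ω → Fin K} {T : ℕ} {π : ℕ → Fin K → Ω → ℝ} {ε : ℝ}

theorem stronglyMeasurable_tsuPolicy (t : ℕ) (a : Fin K) :
    StronglyMeasurable[history G Y A t] (tsuPolicy μ G Astar Y A ε t a) :=
  (stronglyMeasurable_condExp.const_mul (1 - ε)).add stronglyMeasurable_const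

theorem mul_posteriorProb_le_tsuPolicy (hε : 0 ≤ ε) (t : ℕ) (a : Fin K) (ω : Ω) :
    (1 - ε) * posteriorProb μ G Astar Y A t a ω ≤ tsuPolicy μ G Astar Y A ε t a ω :=
  le_add_of_nonneg_right (by positivity)

theorem PlaysPolicy.isAdaptiveSampling [IsFiniteMeasure μ]
    (hplay : PlaysPolicy μ G pstar Y A T π) (hbandit : IsBayesianBandit μ pstar Astar Y)
    (hπ : ∀ t a, StronglyMeasurable[history G Y A t] (π t a)) :
    IsAdaptiveSampling μ G Astar Y A T π where
  measurable_target := hbandit.measurable_Astar.mono hbandit.measurable_pstar.comap_le le_rfl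
  measurable_reward := hbandit.measurable_reward
  measurable_action := hplay.measurable_action
  aestronglyMeasurable_policy t _ a := (hπ t a).aestronglyMeasurable
  sampling t ht a := by
    have hY : Measurable fun ω s => Y s ω := measurable_pi_lambda _ hbandit.measurable_reward
    have hhistory := history_le (G := G) hplay.measurable_action hbandit.measurable_reward t
    refine condExp_ae_eq_of_le ?_ ?_ (hplay.sampling t ht a)
      ((hπ t a).mono history_le_preAction).aestronglyMeasurable
    · exact sup_le_sup (sup_le_sup_left hbandit.measurable_Astar.comap_le _)
        ((measurable_pi_apply t).comp (comap_measurable fun ω s => Y s ω)).comap_le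
    · exact sup_le (sup_le hhistory hbandit.measurable_pstar.comap_le) hY.comap_le

end Policy

end GraphBandit

open GraphBandit in
theorem mainTheorem4_general {Ω : Type*} [MeasurableSpace Ω] {μ : Measure Ω}
    [IsProbabilityMeasure μ] {K : ℕ} {G : ℕ → Digraph (Fin K)} (hG : ∀ t i, (G t).Adj i i)
    {Astar : Ω → Fin K} {Y : ℕ → Ω → RewardVec K} {A : ℕ → Ω → Fin K} {T : ℕ}
    {π : ℕ → Fin K → Ω → ℝ} (h : IsAdaptiveSampling μ G Astar Y A T π) {ε : ℝ} (hε0 : 0 ≤ ε)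
    (hε1 : ε ≤ 1)
    (hε : ∀ t < T, ∀ a, ∀ᵐ ω ∂μ, (1 - ε) * posteriorProb μ G Astar Y A t a ω ≤ π t a ω) :
    bayesRegret μ Astar Y A T ≤ ε * T + Real.sqrt (1 / 2 *
      (∑ t ∈ Finset.range T, ∫ ω, graphQ (G t) (fun a => π t a ω) ∂μ) *
        shannonEntropy (prior μ Astar)) := by
  refine (h.bayesRegret_le hε0 hε).trans (add_le_add_right (Real.le_sqrt_of_sq_le ?_) _)
  rw [mul_assoc, mul_left_comm]
  refine sq_le_mul_of_forall_two_mul_le fun c => ?_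
  calc 2 * c * ∑ t ∈ Finset.range T, (1 - ε) * thompsonRegret μ G Astar Y A t
      ≤ ∑ t ∈ Finset.range T, (c ^ 2 * ∫ ω, graphQ (G t) (fun a => π t a ω) ∂μ
          + observedSqGap μ G Astar Y A π t) := by
        rw [Finset.mul_sum]
        exact Finset.sum_le_sum fun t ht => h.two_mul_thompsonRegret_le (Finset.mem_range.1 ht)
          (hG t) hε0 hε1 (hε t (Finset.mem_range.1 ht)) c
    _ = c ^ 2 * ∑ t ∈ Finset.range T, ∫ ω, graphQ (G t) (fun a => π t a ω) ∂μ
          + ∑ t ∈ Finset.range T, observedSqGap μ G Astar Y A π t := by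
        rw [Finset.sum_add_distrib, ← Finset.mul_sum]
    _ ≤ _ := by linarith [h.two_mul_sum_observedSqGap_le]

theorem mainTheorem4 {Ω : Type*} [MeasurableSpace Ω] (μ : Measure Ω) [IsProbabilityMeasure μ]
    {K : ℕ} (G : ℕ → Digraph (Fin K)) (hG : ∀ t i, (G t).Adj i i)
    (pstar : Ω → ProbabilityMeasure (GraphBandit.RewardVec K)) (Astar : Ω → Fin K)
    (Y : ℕ → Ω → GraphBandit.RewardVec K) (A : ℕ → Ω → Fin K)
    (hbandit : GraphBandit.IsBayesianBandit μ pstar Astar Y)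
    (ε : ℝ) (hε0 : 0 ≤ ε) (hε1 : ε ≤ 1) (T : ℕ)
    (hplay : GraphBandit.PlaysPolicy μ G pstar Y A T
      (GraphBandit.tsuPolicy μ G Astar Y A ε)) :
    GraphBandit.bayesRegret μ Astar Y A T ≤
      ε * T + Real.sqrt (1 / 2 *
        (∑ t ∈ Finset.range T,
          ∫ ω, GraphBandit.graphQ (G t)
            (fun a => GraphBandit.tsuPolicy μ G Astar Y A ε t a ω) ∂μ) *
        GraphBandit.shannonEntropy (GraphBandit.prior μ Astar)) :=
  mainTheorem4_general hG
    (hplay.isAdaptiveSampling hbandit GraphBandit.stronglyMeasurable_tsuPolicy) hε0 hε1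
    fun t _ a => .of_forall fun ω => GraphBandit.mul_posteriorProb_le_tsuPolicy hε0 t a ω
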